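/- **Theorem (Boundary Swapping Theorem).** All spaces are separable and metrizable. A locally compact space $X$ is an *absolute retract* (AR) if, whenever $X$ is embedded as a closed subset of a space $W$, its image is a retract of $W$. An action of a group $G$ on a proper metric space is *geometric* if it is by isometries, cocompact, and properly discontinuous ($\{g\in G: gK\cap K\neq\varnothing\}$ is finite for every compact $K$). A closed subset $A$ of a space $W$ is a *$\mathcal Z$-set* if there is a homotopy $H:W\times[0,1]\to W$ with $H_0=\mathrm{id}_W$ and $H_t(W)\subseteq W-A$ for all $t>0$. A *$\mathcal Z$-structure* on $G$ is a pair of spaces $(\overline X,Z)$ such that 1. $\overline X$ is a compact AR, 2. $Z$ is a $\mathcal Z$-set in $\overline X$, 3. $X=\overline X-Z$ is a proper metric space on which $G$ acts geometrically, and 4. for every compact $C\subseteq X$ and every open cover $\mathcal U$ of $\overline X$, all but finitely many $G$-translates of $C$ lie in an element of $\mathcal U$. If in addition the $G$-action on $X$ extends to an action of $G$ on $\overline X$ by homeomorphisms, then $(\overline X,Z)$ is an *$E\mathcal Z$-structure* on $G$. Let a group $G$ act geometrically on proper metric ARs $X$ and $Y$, and suppose that $Y$ can be compactified to a $\mathcal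 Z$-structure [resp., $E\mathcal Z$-structure] $(\overline Y,Z)$ for $G$, where $\overline Y-Z$ is $Y$ with its given metric and action. Then $X$, with its given metric and action, can be compactified, by addition of the same boundary $Z$, to a $\mathcal Z$-structure [resp., $E\mathcal Z$-structure] $(\overline X,Z)$ for $G$. In the $E\mathcal Z$ case, $\overline X$ can be chosen so that the extended $G$-actions on $\overline X$ and on $\overline Y$ restrict to the same action on $Z$. -/

import Mathlib

open Set Topology TopologicalSpace
open scoped Pointwise

universe u v

/-- An absolute retract, in the class of separable metrizable spaces and with local compactness
as part of the definition: whenever `X` is embedded as a closed subset of a separable metrizable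
space `W`, the space `W` retracts onto `X`. (Taking `W` itself as the neighbourhood, such an `X` is
an absolute neighbourhood retract. The empty space is not an absolute retract.) -/
def IsAR (X : Type u) [TopologicalSpace X] : Prop :=
  LocallyCompactSpace X ∧ MetrizableSpace X ∧ SeparableSpace X ∧
    ∀ (W : Type u) [TopologicalSpace W] [MetrizableSpace W] [SeparableSpace W] (e : X → W),
      IsClosedEmbedding e → ∃ r : W → X, Continuous r ∧ ∀ x, r (e x) = x

/-- A closed subset `A` of `X` is a Z-set if some homotopy starting at the identity instantly
homotopes `X` off from `A`. -/
def IsZSet {X : Type u} [TopologicalSpace X] (A : Set X) : Prop :=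
  IsClosed A ∧ ∃ H : C(X × unitInterval, X),
    (∀ x, H (x, 0) = x) ∧ ∀ x, ∀ t : unitInterval, 0 < t → H (x, t) ∉ A

/-- A geometric action of a (discrete) group: by isometries, cocompact and properly
discontinuous. -/
structure IsGeometricAction (G : Type v) [Group G] (X : Type u) [MetricSpace X] [MulAction G X] :
    Prop where
  isometry : ∀ g : G, Isometry fun x : X => g • x
  cocompact : ∃ K : Set X, IsCompact K ∧ (⋃ g : G, g • K) = univ
  proper : ∀ K : Set X, IsCompact K → {g : G | ((g • K) ∩ K).Nonempty}.Finite

/-- `(Xbar, Z)` is a Z-structure on `G`, where `Z` is regarded as a subspace of `Xbar` through `k`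
and the metric `G`-space `X` is identified with `Xbar - Z` through `i`. -/
structure IsZStructure (G : Type v) [Group G] {X Z Xbar : Type u} [MetricSpace X] [MulAction G X]
    [TopologicalSpace Z] [TopologicalSpace Xbar] (i : X → Xbar) (k : Z → Xbar) : Prop where
  isEmbedding_interior : IsEmbedding i
  isEmbedding_boundary : IsEmbedding k
  range_interior : range i = (range k)ᶜ
  compactSpace : CompactSpace Xbar
  isAR : IsAR Xbar
  isZSet : IsZSet (range k)
  properSpace : ProperSpace X
  isGeometricAction : IsGeometricAction G X
  /-- The nullity condition. As the action is proper, a nonempty compact set is equal to only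
  finitely many of its translates, so that counting the translates `g • C` and counting the
  elements `g` is the same. -/
  nullity : ∀ C : Set X, IsCompact C → ∀ 𝒰 : Set (Set Xbar), (∀ U ∈ 𝒰, IsOpen U) →
    ⋃₀ 𝒰 = univ → {g : G | ¬ ∃ U ∈ 𝒰, i '' (g • C) ⊆ U}.Finite

/-- `(Xbar, Z)` is an EZ-structure on `G`: it is a Z-structure and the action of `G` on `X` extends
to the action `ρ` of `G` on `Xbar` by homeomorphisms. -/
structure IsEZStructure {G : Type v} [Group G] {X Z Xbar : Type u} [MetricSpace X] [MulAction G X]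
    [TopologicalSpace Z] [TopologicalSpace Xbar] (i : X → Xbar) (k : Z → Xbar)
    (ρ : G →* (Xbar ≃ₜ Xbar)) : Prop where
  isZStructure : IsZStructure G i k
  extends_action : ∀ (g : G) (x : X), ρ g (i x) = i (g • x)

universe w

/-! ### Absolute retracts as absolute extensors. -/

lemma IsAR.nonempty {X : Type u} [TopologicalSpace X] (hX : IsAR X) : Nonempty X := by
  by_contra h
  rw [not_nonempty_iff] at h
  -- The empty set is closed in a point, and a retraction onto it would take a value.
  obtain ⟨r, -⟩ := hX.2.2.2 PUnit.{u + 1} (fun _ => PUnit.unit)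
    ⟨IsEmbedding.of_subsingleton _, by simp [range_eq_empty]⟩
  exact h.false (r PUnit.unit)

/-- A proper metric space is a closed subspace of a countable product of lines. -/
lemma exists_isClosedEmbedding_pi (X : Type u) [MetricSpace X] [ProperSpace X] [Nonempty X] :
    ∃ e : X → (ULift.{u} ℕ → ℝ), IsClosedEmbedding e := by
  set e : X → (ULift.{u} ℕ → ℝ) := fun x n => dist x (denseSeq X n.down)
  have hc : Continuous e := by fun_prop
  have hinj : Function.Injective e := by
    intro x x' h
    have key : (fun y => dist x y) = fun y => dist x' y := by
      refine (denseRange_denseSeq X).equalizer (by fun_prop) (by fun_prop) ?_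
      ext n
      exact congrFun h ⟨n⟩
    have := congrFun key x'
    simpa using this
  refine ⟨e, .of_continuous_injective_isClosedMap hc hinj (IsProperMap.isClosedMap ?_)⟩
  rw [isProperMap_iff_isCompact_preimage]
  refine ⟨hc, fun K hK => Metric.isCompact_of_isClosed_isBounded (hK.isClosed.preimage hc) ?_⟩
  obtain ⟨M, hM⟩ := (hK.image (continuous_apply (⟨0⟩ : ULift ℕ))).isBounded.bddAbove
  -- One coordinate, the distance to a fixed point, already confines the preimage to a ball.
  have hs : e ⁻¹' K ⊆ Metric.closedBall (denseSeq X 0) M := fun x hx => hM ⟨e x, hx, rfl⟩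
  exact Metric.isBounded_closedBall.subset hs

/-- A proper metric absolute retract is a retract of a countable product of lines. -/
lemma IsAR.exists_retraction_pi {X : Type u} [MetricSpace X] [ProperSpace X] (hX : IsAR X) :
    ∃ (e : C(X, ULift.{u} ℕ → ℝ)) (r : C(ULift.{u} ℕ → ℝ, X)), ∀ x, r (e x) = x := by
  have := hX.nonempty
  obtain ⟨e, he⟩ := exists_isClosedEmbedding_pi X
  obtain ⟨r, hr, h⟩ := hX.2.2.2 _ e he
  exact ⟨⟨e, he.continuous⟩, ⟨r, hr⟩, h⟩

/-- Absolute retracts are absolute extensors. -/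
lemma IsAR.exists_extension {X : Type u} [MetricSpace X] [ProperSpace X] (hX : IsAR X)
    {A W : Type w} [TopologicalSpace A] [TopologicalSpace W] [NormalSpace W]
    {e : A → W} (he : IsClosedEmbedding e) (f : C(A, X)) :
    ∃ F : C(W, X), ∀ a, F (e a) = f a := by
  obtain ⟨ι, r, hr⟩ := hX.exists_retraction_pi
  obtain ⟨g, hg⟩ := ContinuousMap.exists_extension he (ι.comp f)
  refine ⟨r.comp g, fun a => ?_⟩
  have := DFunLike.congr_fun hg a
  simp only [ContinuousMap.comp_apply, ContinuousMap.coe_mk] at this ⊢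
  rw [this, hr]

/-- Maps from closed subsets into a compact set `K` extend with values in a compact set `K'` that
depends only on `K`. -/
lemma IsAR.exists_extension_compact {X : Type u} [MetricSpace X] [ProperSpace X] (hX : IsAR X)
    {K : Set X} (hK : IsCompact K) :
    ∃ K' : Set X, IsCompact K' ∧ ∀ (W : Type w) [TopologicalSpace W] [NormalSpace W] (A : Set W)
      (f : W → X), IsClosed A → ContinuousOn f A → MapsTo f A K →
        ∃ F : C(W, X), EqOn F f A ∧ ∀ w, F w ∈ K' := by
  obtain ⟨e, r, hr⟩ := hX.exists_retraction_pi
  have hb : ∀ n, ∃ M : ℝ, 0 ≤ M ∧ ∀ x ∈ K, |e x n| ≤ M := by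
    intro n
    obtain ⟨M, hM⟩ := hK.exists_bound_of_continuousOn
      (f := fun x => e x n) (by fun_prop)
    exact ⟨max M 0, le_max_right _ _, fun x hx => (hM x hx).trans (le_max_left _ _)⟩
  choose M hM0 hM using hb
  -- The Tietze extension is clamped to a box around the image of `K`; the box and its image under
  -- `r` depend on `K` alone.
  set B : Set (ULift.{u} ℕ → ℝ) := Set.pi univ fun n => Icc (-M n) (M n)
  have hB : IsCompact B := isCompact_univ_pi fun n => isCompact_Icc
  set c : (ULift.{u} ℕ → ℝ) → (ULift.{u} ℕ → ℝ) := fun p n => max (-M n) (min (M n) (p n))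
  have hc : Continuous c := by fun_prop
  refine ⟨r '' B, hB.image r.continuous, fun W _ _ A f hA hf hm => ?_⟩
  obtain ⟨g, hg⟩ := ContinuousMap.exists_restrict_eq hA
    (e.comp ⟨A.domRestrict f, continuousOn_iff_continuous_domRestrict.1 hf⟩)
  refine ⟨r.comp ⟨fun w => c (g w), by fun_prop⟩, fun w hw => ?_, fun w => ⟨c (g w), ?_, rfl⟩⟩
  · have h1 : g w = e (f w) := DFunLike.congr_fun hg ⟨w, hw⟩
    have h2 : c (g w) = e (f w) := by
      ext n
      have := abs_le.1 (hM n _ (hm hw))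
      simp [c, h1, this.1, this.2]
    simp [h2, hr]
  · intro n _
    simp only [c]
    exact ⟨le_max_left _ _, max_le (by linarith [hM0 n]) (min_le_left _ _)⟩

/-! ### Colourings and controlled extension over cells. -/

/-- Greedy colouring: finitely many colours separate the elements of `G` that differ by an element
of a given finite set. -/
lemma exists_finite_coloring (G : Type v) [Group G] {S : Set G} (hS : S.Finite) :
    ∃ (n : ℕ) (c : G → Fin n), ∀ g h, c g = c h → g⁻¹ * h ∈ S → g = h := by
  classical
  -- Symmetrized, since either of two elements may come first in the well-order.
  set S' : Finset G := hS.toFinset ∪ hS.toFinset⁻¹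
  have hS' : ∀ g h : G, g⁻¹ * h ∈ S → g⁻¹ * h ∈ S' ∧ h⁻¹ * g ∈ S' := by
    intro g h hgh
    have : (h⁻¹ * g)⁻¹ ∈ S := by simpa using hgh
    simp only [S', Finset.mem_union, Finset.mem_inv', Set.Finite.mem_toFinset]
    exact ⟨Or.inl hgh, Or.inr this⟩
  set n := S'.card + 1
  have wf : WellFounded (@WellOrderingRel G) := WellOrderingRel.isWellOrder.wf
  have hfree : ∀ (g : G) (p : ∀ h, WellOrderingRel h g → Fin n),
      ∃ a : Fin n, ∀ h (hh : WellOrderingRel h g), g⁻¹ * h ∈ S' → p h hh ≠ a := by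
    intro g p
    set used : Finset (Fin n) := S'.image fun s =>
      if hh : WellOrderingRel (g * s) g then p (g * s) hh else 0
    have hcard : used.card < (Finset.univ : Finset (Fin n)).card := by
      simpa [n] using Nat.lt_succ_of_le Finset.card_image_le
    obtain ⟨a, -, ha⟩ := Finset.exists_mem_notMem_of_card_lt_card hcard
    refine ⟨a, fun h hh hs e => ha ?_⟩
    refine Finset.mem_image.2 ⟨g⁻¹ * h, hs, ?_⟩
    simp [hh, e]
  choose F hF using hfree
  set c : G → Fin n := wf.fix F
  have hc : ∀ g h, WellOrderingRel h g → g⁻¹ * h ∈ S' → c h ≠ c g := by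
    intro g h hh hs
    have := hF g (fun h _ => c h) h hh hs
    rwa [show c g = F g (fun h _ => c h) from wf.fix_eq F g]
  refine ⟨n, c, fun g h e hs => ?_⟩
  obtain ⟨h1, h2⟩ := hS' g h hs
  rcases trichotomous_of WellOrderingRel g h with hlt | heq | hgt
  · exact absurd e (hc h g hlt h2)
  · exact heq
  · exact absurd e.symm (hc g h hgt h1)

/-- Extension over finitely many colours of cells, with control up to translation. -/
lemma IsAR.exists_extension_colors {G : Type v} [Group G] {Y : Type u} [MetricSpace Y]
    [ProperSpace Y] [MulAction G Y] [ContinuousConstSMul G Y] (hY : IsAR Y)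
    {W : Type w} [TopologicalSpace W] [NormalSpace W] {D : G → Set W}
    (hD : ∀ g, IsClosed (D g)) (hlf : LocallyFinite D)
    {S : Set G} (hS : S.Finite) (hDS : ∀ g h, (D g ∩ D h).Nonempty → g⁻¹ * h ∈ S)
    {n : ℕ} (c : G → Fin n) (hc : ∀ g h, c g = c h → g⁻¹ * h ∈ S → g = h)
    {A : Set W} (hA : IsClosed A) {f : W → Y} (hf : ContinuousOn f A)
    {K : Set Y} (hK : IsCompact K) (hfK : ∀ g, MapsTo f (A ∩ D g) (g • K)) (m : ℕ) :
    ∃ (F : W → Y) (K' : Set Y), IsCompact K' ∧ EqOn F f A ∧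
      ContinuousOn F (A ∪ ⋃ g ∈ {g | (c g : ℕ) < m}, D g) ∧
      ∀ g, MapsTo F ((A ∪ ⋃ g ∈ {g | (c g : ℕ) < m}, D g) ∩ D g) (g • K') := by
  classical
  induction m with
  | zero => exact ⟨f, K, hK, fun _ _ => rfl, by simpa using hf, by simpa using hfK⟩
  | succ m ih =>
    obtain ⟨F, K₁, hK₁, hFf, hFc, hFK⟩ := ih
    set B : Set W := A ∪ ⋃ g ∈ {g | (c g : ℕ) < m}, D g with hB
    have hBc : IsClosed B := by
      refine hA.union ?_
      rw [biUnion_eq_iUnion]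
      exact (hlf.comp_injective Subtype.val_injective).isClosed_iUnion fun g => hD g
    obtain ⟨K₂, hK₂, hext⟩ := hY.exists_extension_compact.{u, w} hK₁
    have hE : ∀ g, ∃ E : C(W, Y), EqOn E F (B ∩ D g) ∧ ∀ w, E w ∈ g • K₂ := by
      intro g
      -- Translating by `g⁻¹` brings the prescribed values into the single compact set `K₁`, so one
      -- `K₂` serves all cells.
      obtain ⟨E, hE1, hE2⟩ := hext W (B ∩ D g) (fun w => g⁻¹ • F w) (hBc.inter (hD g))
        ((hFc.mono inter_subset_left).const_smul g⁻¹)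
        (fun w hw => mem_smul_set_iff_inv_smul_mem.1 (hFK g hw))
      refine ⟨⟨fun w => g • E w, by fun_prop⟩, fun w hw => ?_, fun w => smul_mem_smul_set (hE2 w)⟩
      simp [hE1 hw]
    choose E hEF hEK using hE
    set cell : W → Prop := fun w => ∃ g, (c g : ℕ) = m ∧ w ∈ D g
    set F' : W → Y := fun w => if w ∈ B then F w else
      if h : cell w then E h.choose w else F w with hF'
    have hF'B : EqOn F' F B := fun w hw => by simp [hF', hw]
    have hF'E : ∀ g, (c g : ℕ) = m → EqOn F' (E g) (D g) := by
      intro g hg w hw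
      by_cases hwB : w ∈ B
      · rw [hF'B hwB, hEF g ⟨hwB, hw⟩]
      · have h : cell w := ⟨g, hg, hw⟩
        -- Cells of one colour that meet are equal, so the choice is forced.
        have hgg : g = h.choose :=
          hc _ _ (Fin.ext (hg.trans h.choose_spec.1.symm)) (hDS _ _ ⟨w, hw, h.choose_spec.2⟩)
        simp only [hF', hwB, if_false, dif_pos h, ← hgg]
    have hBsucc : A ∪ ⋃ g ∈ {g | (c g : ℕ) < m + 1}, D g =
        B ∪ ⋃ g : {g // (c g : ℕ) = m}, D g := by
      ext w
      simp only [hB, mem_union, mem_iUnion, mem_ofPred_eq, exists_prop, Subtype.exists,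
        Nat.lt_succ_iff_lt_or_eq, or_and_right, exists_or, or_assoc]
    rw [hBsucc]
    -- A point of `D h` may get its value from another cell `D g`; then `g = h * s` with `s ∈ S`,
    -- which accounts for the translates of `K₂`.
    refine ⟨F', K₁ ∪ ⋃ s ∈ S, s • K₂, hK₁.union (hS.isCompact_biUnion fun s _ => hK₂.smul s),
      fun w hw => (hF'B (Or.inl hw)).trans (hFf hw), ?_, ?_⟩
    · have hlf' : LocallyFinite fun g : {g // (c g : ℕ) = m} => D g :=
        hlf.comp_injective Subtype.val_injective
      refine ContinuousOn.union_of_isClosed (hFc.congr hF'B)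
        (hlf'.continuousOn_iUnion (fun g => hD g) fun g => ?_) hBc
        (hlf'.isClosed_iUnion fun g => hD g)
      exact (E g).continuous.continuousOn.congr (hF'E g g.2)
    · rintro h w ⟨hw | hw, hwh⟩
      · rw [hF'B hw]
        exact smul_set_mono subset_union_left (hFK h ⟨hw, hwh⟩)
      · obtain ⟨⟨g, hg⟩, hwg⟩ := mem_iUnion.1 hw
        rw [hF'E g hg hwg, mem_smul_set_iff_inv_smul_mem]
        refine Or.inr (mem_biUnion (hDS h g ⟨w, hwh, hwg⟩) ?_)
        obtain ⟨y, hy, hyE⟩ := hEK g w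
        exact ⟨y, hy, by simp [← hyE, mul_smul]⟩

/-- Maps into a geometric absolute retract extend from closed subsets of a space that is covered by
a `G`-indexed family of cells, with control up to translation. -/
lemma IsAR.exists_controlled_extension {G : Type v} [Group G] {Y : Type u} [MetricSpace Y]
    [ProperSpace Y] [MulAction G Y] [ContinuousConstSMul G Y] (hY : IsAR Y)
    {W : Type w} [TopologicalSpace W] [NormalSpace W] {D : G → Set W}
    (hD : ∀ g, IsClosed (D g)) (hlf : LocallyFinite D) (hcov : ⋃ g, D g = univ)
    {S : Set G} (hS : S.Finite) (hDS : ∀ g h, (D g ∩ D h).Nonempty → g⁻¹ * h ∈ S)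
    {A : Set W} (hA : IsClosed A) {f : W → Y} (hf : ContinuousOn f A)
    {K : Set Y} (hK : IsCompact K) (hfK : ∀ g, MapsTo f (A ∩ D g) (g • K)) :
    ∃ (F : C(W, Y)) (K' : Set Y), IsCompact K' ∧ EqOn F f A ∧ ∀ g, MapsTo F (D g) (g • K') := by
  obtain ⟨n, c, hc⟩ := exists_finite_coloring G hS
  obtain ⟨F, K', hK', hFf, hFc, hFK⟩ :=
    hY.exists_extension_colors hD hlf hS hDS c hc hA hf hK hfK n
  have : A ∪ ⋃ g ∈ {g | (c g : ℕ) < n}, D g = univ := by simp [hcov]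
  simp only [this, univ_inter, continuousOn_univ] at hFc hFK
  exact ⟨⟨F, hFc⟩, K', hK', hFf, hFK⟩

/-! ### Geometric actions and controlled maps. -/

namespace IsGeometricAction

variable {G : Type v} [Group G] {X : Type u} [MetricSpace X] [MulAction G X]

lemma continuousConstSMul (h : IsGeometricAction G X) : ContinuousConstSMul G X :=
  ⟨fun g => (h.isometry g).continuous⟩

lemma finite_inter (h : IsGeometricAction G X) {K L : Set X} (hK : IsCompact K)
    (hL : IsCompact L) : {g : G | ((g • K) ∩ L).Nonempty}.Finite :=
  (h.proper _ (hK.union hL)).subset fun _ hg =>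
    hg.mono (inter_subset_inter (smul_set_mono subset_union_left) subset_union_right)

/-- After translation by `g⁻¹`, whether the two sets meet depends only on `g⁻¹ * g'`. This is the
form of properness that the colouring uses. -/
lemma finite_mul (h : IsGeometricAction G X) {K L : Set X} (hK : IsCompact K)
    (hL : IsCompact L) : ∃ S : Set G, S.Finite ∧
      ∀ g g' : G, ((g • K) ∩ (g' • L)).Nonempty → g⁻¹ * g' ∈ S := by
  refine ⟨_, h.finite_inter hL hK, ?_⟩
  rintro g g' ⟨_, ⟨x, hx, rfl⟩, y, hy, hxy⟩
  refine ⟨x, ⟨y, hy, ?_⟩, hx⟩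
  simp only at hxy ⊢
  rw [mul_smul, hxy, inv_smul_smul]

lemma locallyFinite [WeaklyLocallyCompactSpace X] (h : IsGeometricAction G X) {K : Set X}
    (hK : IsCompact K) : LocallyFinite fun g : G => g • K := by
  intro x
  obtain ⟨L, hL, hx⟩ := exists_compact_mem_nhds x
  exact ⟨L, hx, h.finite_inter hK hL⟩

end IsGeometricAction

/-- A map is controlled if it is equivariant up to a compact error. -/
def IsControlled (G : Type v) [Group G] {X Y : Type*} [TopologicalSpace X] [TopologicalSpace Y]
    [MulAction G X] [MulAction G Y] (f : X → Y) : Prop :=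
  ∀ C : Set X, IsCompact C → ∃ C' : Set Y, IsCompact C' ∧ ∀ g : G, MapsTo f (g • C) (g • C')

lemma IsControlled.comp {G : Type v} [Group G] {X Y V : Type*} [TopologicalSpace X]
    [TopologicalSpace Y] [TopologicalSpace V] [MulAction G X] [MulAction G Y] [MulAction G V]
    {f : Y → V} {h : X → Y} (hf : IsControlled G f) (hh : IsControlled G h) :
    IsControlled G (f ∘ h) := by
  intro C hC
  obtain ⟨C₁, hC₁, h₁⟩ := hh C hC
  obtain ⟨C₂, hC₂, h₂⟩ := hf C₁ hC₁
  exact ⟨C₂, hC₂, fun g => (h₂ g).comp (h₁ g)⟩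

/-- Control on the translates of a single covering compact set is enough. -/
lemma IsGeometricAction.isControlled {G : Type v} [Group G] {X Y : Type*} [MetricSpace X]
    [TopologicalSpace Y] [MulAction G X] [MulAction G Y] [ContinuousConstSMul G Y]
    (hX : IsGeometricAction G X) {f : X → Y} {K : Set X} (hK : IsCompact K)
    (hcov : ⋃ g : G, g • K = univ) {K' : Set Y} (hK' : IsCompact K')
    (hf : ∀ g : G, MapsTo f (g • K) (g • K')) : IsControlled G f := by
  intro C hC
  obtain ⟨S, hS, hCS⟩ := hX.finite_mul hC hK
  refine ⟨⋃ s ∈ S, s • K', hS.isCompact_biUnion fun s _ => hK'.smul s, ?_⟩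
  intro g x hx
  obtain ⟨g', hg'⟩ := mem_iUnion.1 (hcov.symm ▸ mem_univ x : x ∈ ⋃ g : G, g • K)
  obtain ⟨y, hy, hyx⟩ := hf g' hg'
  rw [mem_smul_set_iff_inv_smul_mem]
  exact mem_biUnion (hCS g g' ⟨x, hx, hg'⟩) ⟨y, hy, by simp [← hyx, mul_smul]⟩

/-- Controlled extension from the empty set, with the translates of a covering compact set as cells.
-/
lemma IsAR.exists_controlled_map {G : Type v} [Group G] {X Y : Type u} [MetricSpace X]
    [ProperSpace X] [MulAction G X] [MetricSpace Y] [ProperSpace Y] [MulAction G Y]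
    (hGX : IsGeometricAction G X) (hY : IsAR Y) (hGY : IsGeometricAction G Y) :
    ∃ f : C(X, Y), IsControlled G f := by
  have := hGX.continuousConstSMul
  have := hGY.continuousConstSMul
  have := hY.nonempty
  obtain ⟨K, hK, hcov⟩ := hGX.cocompact
  obtain ⟨S, hS, hKS⟩ := hGX.finite_mul hK hK
  obtain ⟨f, K', hK', -, hf⟩ := hY.exists_controlled_extension (A := (∅ : Set X))
    (fun g => (hK.smul g).isClosed) (hGX.locallyFinite hK) hcov hS hKS isClosed_empty
    (f := fun _ => Classical.arbitrary Y) (continuousOn_empty _) isCompact_empty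
    (by simp [MapsTo])
  exact ⟨f, hGX.isControlled hK hcov hK' hf⟩

/-- Controlled self-maps of a geometric absolute retract are homotopic to the identity through a
controlled homotopy. -/
lemma IsAR.exists_controlled_homotopy {G : Type v} [Group G] {X : Type u} [MetricSpace X]
    [ProperSpace X] [MulAction G X] (hX : IsAR X) (hGX : IsGeometricAction G X)
    (p : C(X, X)) (hp : IsControlled G p) :
    ∃ J : C(X × unitInterval, X), (∀ x, J (x, 0) = x) ∧ (∀ x, J (x, 1) = p x) ∧
      ∀ C : Set X, IsCompact C → ∃ C' : Set X, IsCompact C' ∧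
        ∀ g : G, ∀ x ∈ g • C, ∀ t, J (x, t) ∈ g • C' := by
  have := hGX.continuousConstSMul
  obtain ⟨K, hK, hcov⟩ := hGX.cocompact
  obtain ⟨S, hS, hKS⟩ := hGX.finite_mul hK hK
  obtain ⟨L, hL, hpL⟩ := hp K hK
  -- Only the values at the two ends matter; the cells are the cylinders over the translates of `K`.
  set f : X × unitInterval → X := fun q => if q.2 = 0 then q.1 else p q.1 with hf
  have hA₀ : IsClosed {q : X × unitInterval | q.2 = 0} := isClosed_eq continuous_snd
    continuous_const
  have hA₁ : IsClosed {q : X × unitInterval | q.2 = 1} := isClosed_eq continuous_snd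
    continuous_const
  have hf₀ : EqOn f Prod.fst {q | q.2 = 0} := fun q (hq : q.2 = 0) => by simp [hf, hq]
  have hf₁ : EqOn f (fun q => p q.1) {q | q.2 = 1} := fun q (hq : q.2 = 1) => by simp [hf, hq]
  obtain ⟨J, K', hK', hJf, hJ⟩ := hX.exists_controlled_extension
    (D := fun g : G => Prod.fst ⁻¹' (g • K)) (W := X × unitInterval)
    (fun g => (hK.smul g).isClosed.preimage continuous_fst)
    ((hGX.locallyFinite hK).preimage_continuous continuous_fst)
    (by rw [← preimage_iUnion, hcov, preimage_univ]) hS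
    (fun g h ⟨q, hq⟩ => hKS g h ⟨q.1, hq⟩) (hA₀.union hA₁)
    (ContinuousOn.union_of_isClosed (continuous_fst.continuousOn.congr hf₀)
      ((p.continuous.comp continuous_fst).continuousOn.congr hf₁) hA₀ hA₁)
    (hK.union hL) (by
      rintro g q ⟨hq | hq, hqg⟩
      · rw [hf₀ hq]
        exact smul_set_mono subset_union_left hqg
      · rw [hf₁ hq]
        exact smul_set_mono subset_union_right (hpL g hqg))
  refine ⟨J, fun x => (hJf (Or.inl rfl)).trans (hf₀ (x := (x, 0)) rfl),
    fun x => (hJf (Or.inr rfl)).trans (hf₁ (x := (x, 1)) rfl), fun C hC => ?_⟩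
  obtain ⟨S', hS', hCS⟩ := hGX.finite_mul hC hK
  refine ⟨⋃ s ∈ S', s • K', hS'.isCompact_biUnion fun s _ => hK'.smul s, ?_⟩
  intro g x hx t
  obtain ⟨g', hg'⟩ := mem_iUnion.1 (hcov.symm ▸ mem_univ x : x ∈ ⋃ g : G, g • K)
  obtain ⟨y, hy, hyx⟩ := hJ g' (x := (x, t)) hg'
  rw [mem_smul_set_iff_inv_smul_mem]
  exact mem_biUnion (hCS g g' ⟨x, hx, hg'⟩) ⟨y, hy, by simp [← hyx, mul_smul]⟩

/-! ### Spaces that move instantly into an absolute retract. -/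

/-- A positive function that vanishes on a compact set `K` exactly, and so slowly that its graph
lies in a given neighbourhood of `K × (0, 1]`. -/
lemma exists_slow_function {W : Type*} [MetricSpace W] {K : Set W} (hK : IsCompact K)
    (hne : K.Nonempty) {N : Set (W × unitInterval)} (hN : IsOpen N)
    (hKN : ∀ w ∈ K, ∀ t, 0 < t → (w, t) ∈ N) :
    ∃ φ : C(W, unitInterval), (∀ w ∈ K, φ w = 0) ∧ (∀ w ∉ K, 0 < φ w) ∧
      ∃ U : Set W, IsOpen U ∧ K ⊆ U ∧ ∀ w ∈ U, w ∉ K → (w, φ w) ∈ N := by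
  have hδ : ∀ n : ℕ, ∃ δ : ℝ, 0 < δ ∧ ∀ w, Metric.infDist w K < δ →
      ∀ t : unitInterval, (1 / 2 : ℝ) ^ (n + 3) ≤ t → (w, t) ∈ N := by
    intro n
    have hI : IsCompact {t : unitInterval | (1 / 2 : ℝ) ^ (n + 3) ≤ t} :=
      (isClosed_le continuous_const continuous_subtype_val).isCompact
    obtain ⟨u, v, hu, -, hKu, hIv, huv⟩ := generalized_tube_lemma hK hI hN (by
      rintro ⟨w, t⟩ ⟨hw, ht⟩
      refine hKN w hw t (?_ : (0 : ℝ) < t)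
      exact lt_of_lt_of_le (by positivity) ht)
    obtain ⟨δ, hδ, hδu⟩ := hK.exists_thickening_subset_open hu hKu
    refine ⟨δ, hδ, fun w hw t ht => huv ⟨hδu ?_, hIv ht⟩⟩
    rwa [Metric.mem_thickening_iff_infDist_lt hne]
  choose δ hδ0 hδN using hδ
  -- The weights sum to 1, and the `n`-th term reaches its full weight (1/2)^(n+1) once the distance
  -- to `K` is at least `δ n`. So a small sum forces a small distance.
  set a : ℕ → W → ℝ := fun n w => 1 / 2 * (1 / 2) ^ n * min 1 (Metric.infDist w K / δ n) with ha
  have ha0 : ∀ n w, 0 ≤ a n w := fun n w => by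
    have := Metric.infDist_nonneg (x := w) (s := K)
    have := (hδ0 n).le
    positivity
  have ha1 : ∀ n w, a n w ≤ 1 / 2 * (1 / 2) ^ n := fun n w =>
    mul_le_of_le_one_right (by positivity) (min_le_left _ _)
  have hsum : HasSum (fun n : ℕ => 1 / 2 * (1 / 2 : ℝ) ^ n) 1 := by
    simpa using hasSum_geometric_two.mul_left (1 / 2 : ℝ)
  have hsa : ∀ w, Summable fun n => a n w := fun w =>
    Summable.of_nonneg_of_le (fun n => ha0 n w) (fun n => ha1 n w) hsum.summable
  have hcont : Continuous fun w => ∑' n, a n w := by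
    refine continuous_tsum (fun n => ?_) hsum.summable fun n w => ?_
    · exact continuous_const.mul (continuous_const.min
        ((Metric.continuous_infDist_pt K).div_const _))
    · rw [Real.norm_of_nonneg (ha0 n w)]
      exact ha1 n w
  have hle : ∀ w n, a n w ≤ ∑' n, a n w := fun w n =>
    (hsa w).le_tsum n fun m _ => ha0 m w
  set φ : C(W, unitInterval) := ⟨fun w => ⟨∑' n, a n w, tsum_nonneg fun n => ha0 n w,
    hsum.tsum_eq ▸ (hsa w).tsum_le_tsum (fun n => ha1 n w) hsum.summable⟩,
    hcont.subtype_mk _⟩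
  have hφ : ∀ w, (φ w : ℝ) = ∑' n, a n w := fun w => rfl
  have hφK : ∀ w ∈ K, φ w = 0 := fun w hw => Subtype.ext (by
    simp [hφ, ha, Metric.infDist_zero_of_mem hw])
  refine ⟨φ, hφK, fun w hw => (?_ : (0 : ℝ) < φ w), {w | (φ w : ℝ) < 1 / 4}, ?_, ?_, ?_⟩
  · refine lt_of_lt_of_le ?_ (hle w 0)
    have := (hK.isClosed.notMem_iff_infDist_pos hne).1 hw
    have := hδ0 0
    positivity
  · exact isOpen_lt (by fun_prop) continuous_const
  · intro w hw
    change (φ w : ℝ) < 1 / 4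
    simp [hφK w hw]
  · intro w (hw : (φ w : ℝ) < 1 / 4) hwK
    have hpos : (0 : ℝ) < φ w := by
      refine lt_of_lt_of_le ?_ (hle w 0)
      have := (hK.isClosed.notMem_iff_infDist_pos hne).1 hwK
      have := hδ0 0
      positivity
    -- With n = k + 2, the upper bound (1/2)^(k+2) on `φ w` is below the full weight (1/2)^(k+1), so
    -- the distance is less than `δ k`; the lower bound (1/2)^(k+3) is the height that `hδN k`
    -- requires. The cutoff 1/4 ensures n ≥ 2.
    obtain ⟨n, hn1, hn2⟩ := exists_nat_pow_near_of_lt_one hpos (φ w).2.2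
      (by norm_num : (0 : ℝ) < 1 / 2) (by norm_num)
    have hn : 2 ≤ n := by
      by_contra! h
      have : (1 / 2 : ℝ) ^ 2 ≤ (1 / 2) ^ (n + 1) :=
        pow_le_pow_of_le_one (by norm_num) (by norm_num) (by omega)
      linarith
    obtain ⟨k, rfl⟩ := Nat.exists_eq_add_of_le' hn
    refine hδN k w ?_ _ hn1.le
    by_contra! h
    have h1 : a k w = 1 / 2 * (1 / 2) ^ k := by
      simp only [ha]
      rw [min_eq_left ((one_le_div (hδ0 k)).2 h), mul_one]
    have h2 := hle w k
    rw [← hφ, h1] at h2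
    have h3 : (0 : ℝ) < (1 / 2) ^ k := by positivity
    have h4 : ((1 : ℝ) / 2) ^ (k + 2) = 1 / 4 * (1 / 2) ^ k := by ring
    linarith

/-- A compact metrizable space that can be instantly homotoped into a locally compact absolute
retract contained in it is an absolute retract. -/
theorem IsAR.of_instant_homotopy {X T : Type u} [MetricSpace X] [ProperSpace X] (hX : IsAR X)
    [TopologicalSpace T] [CompactSpace T] [MetrizableSpace T] {i : X → T} (hi : IsEmbedding i)
    (H : C(T × unitInterval, T)) (H₀ : ∀ x, H (x, 0) = x)
    (H₁ : ∀ x, ∀ t : unitInterval, 0 < t → H (x, t) ∈ range i) : IsAR T := by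
  let _ := metrizableSpaceMetric T
  refine ⟨inferInstance, inferInstance, inferInstance, fun W _ _ _ e he => ?_⟩
  let _ := metrizableSpaceMetric W
  have := hX.nonempty.map i
  choose p hp using fun q : T × {t : unitInterval // 0 < t} => H₁ q.1 q.2.1 q.2.2
  have hpc : Continuous p := by
    rw [hi.continuous_iff, show i ∘ p = fun q => H (q.1, q.2.1) from funext hp]
    fun_prop
  obtain ⟨P, hP⟩ := hX.exists_extension
    (he.prodMap (.id : IsClosedEmbedding (id : {t : unitInterval // 0 < t} → _))) ⟨p, hpc⟩
  -- At positive times `H` is a map into `X` and extends to `P` on W × (0,1]. On `V` the extension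
  -- is still close to `H`; the retraction will be `P` along the graph of a function slow enough to
  -- stay in `V` near the image of `e`.
  set V : Set (W × {t : unitInterval // 0 < t}) := {q | ∃ x : T, dist q.1 (e x) < (q.2.1 : ℝ) ∧
    dist (i (P q)) (H (x, q.2.1)) < (q.2.1 : ℝ)} with hV
  have hVo : IsOpen V := by
    have := hi.continuous
    simp only [hV, ofPred_exists]
    refine isOpen_iUnion fun x => (isOpen_lt ?_ ?_).and (isOpen_lt ?_ ?_) <;> fun_prop
  have hemb : IsOpenEmbedding
      (Prod.map id Subtype.val : W × {t : unitInterval // 0 < t} → W × unitInterval) :=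
    IsOpenEmbedding.id.prodMap (isOpen_lt continuous_const continuous_id).isOpenEmbedding_subtypeVal
  obtain ⟨φ, hφ0, hφpos, U, hUo, hKU, hU⟩ := exists_slow_function
    (isCompact_range he.continuous) (range_nonempty e) (hemb.isOpenMap _ hVo) (by
      rintro _ ⟨x, rfl⟩ t ht
      refine ⟨(e x, ⟨t, ht⟩), ⟨x, ?_, ?_⟩, rfl⟩
      · simpa using ht
      · have h1 : P (e x, ⟨t, ht⟩) = p (x, ⟨t, ht⟩) := hP (x, ⟨t, ht⟩)
        have h2 : i (p (x, ⟨t, ht⟩)) = H (x, t) := hp (x, ⟨t, ht⟩)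
        simp only [h1, h2, dist_self]
        exact ht)
  have hnear : ∀ w ∈ U, ∀ hw : w ∉ range e, ∃ x, dist w (e x) < (φ w : ℝ) ∧
      dist (i (P (w, ⟨φ w, hφpos w hw⟩))) (H (x, φ w)) < (φ w : ℝ) := by
    intro w hwU hw
    obtain ⟨⟨w', t, ht⟩, ⟨x, hx⟩, heq⟩ := hU w hwU hw
    simp only [Prod.map_apply, id, Prod.mk.injEq] at heq
    obtain ⟨rfl, rfl⟩ := heq
    exact ⟨x, hx⟩
  classical
  set r : W → T := fun w => if hw : w ∈ range e then hw.choose else i (P (w, ⟨φ w, hφpos w hw⟩))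
    with hr
  have hre : ∀ x, r (e x) = x := fun x => by
    have h : e x ∈ range e := ⟨x, rfl⟩
    simp only [hr, dif_pos h]
    exact he.injective h.choose_spec
  refine ⟨r, continuous_iff_continuousAt.2 fun w => ?_, hre⟩
  by_cases hw : w ∈ range e
  · obtain ⟨x₀, rfl⟩ := hw
    -- nearby points `q w` of `T` such that `r w` is close to `H (q w, φ w)`
    have hq : ∀ w ∈ U, ∃ x, dist w (e x) ≤ (φ w : ℝ) ∧
        dist (r w) (H (x, φ w)) ≤ (φ w : ℝ) := by
      intro w hwU
      by_cases hw : w ∈ range e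
      · obtain ⟨x, rfl⟩ := hw
        exact ⟨x, by simpa using (φ (e x)).2.1, by simp [hre, hφ0 (e x) ⟨x, rfl⟩, H₀]⟩
      · obtain ⟨x, h1, h2⟩ := hnear w hwU hw
        exact ⟨x, h1.le, by simpa only [hr, dif_neg hw] using h2.le⟩
    have : ∀ w, ∃ x, w ∈ U → dist w (e x) ≤ (φ w : ℝ) ∧
        dist (r w) (H (x, φ w)) ≤ (φ w : ℝ) := fun w => by
      by_cases hwU : w ∈ U
      · obtain ⟨x, hx⟩ := hq w hwU
        exact ⟨x, fun _ => hx⟩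
      · exact ⟨x₀, fun h => absurd h hwU⟩
    choose q hq using this
    have hUn : ∀ᶠ w in 𝓝 (e x₀), w ∈ U := hUo.mem_nhds (hKU ⟨x₀, rfl⟩)
    have hφt : Filter.Tendsto φ (𝓝 (e x₀)) (𝓝 0) := by
      simpa [hφ0 (e x₀) ⟨x₀, rfl⟩] using φ.continuous.tendsto (e x₀)
    have hφr : Filter.Tendsto (fun w => (φ w : ℝ)) (𝓝 (e x₀)) (𝓝 0) := by
      simpa [Function.comp_def] using
        (continuous_subtype_val.tendsto (0 : unitInterval)).comp hφt
    have hqt : Filter.Tendsto q (𝓝 (e x₀)) (𝓝 x₀) := by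
      rw [he.isInducing.tendsto_nhds_iff]
      have h : Filter.Tendsto (fun w => dist w ((e ∘ q) w)) (𝓝 (e x₀)) (𝓝 0) :=
        squeeze_zero' (.of_forall fun _ => dist_nonneg) (hUn.mono fun w hw => (hq w hw).1) hφr
      exact Filter.Tendsto.congr_dist (Filter.tendsto_id) h
    have hHt : Filter.Tendsto (fun w => H (q w, φ w)) (𝓝 (e x₀)) (𝓝 x₀) := by
      have := (H.continuous.tendsto (x₀, 0)).comp (hqt.prodMk_nhds hφt)
      rwa [H₀] at this
    rw [ContinuousAt, hre]
    refine Filter.Tendsto.congr_dist hHt (squeeze_zero' (.of_forall fun _ => dist_nonneg)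
      (hUn.mono fun w hw => ?_) hφr)
    rw [dist_comm]
    exact (hq w hw).2
  · have hO : IsOpen (range e)ᶜ := he.isClosed_range.isOpen_compl
    refine ContinuousOn.continuousAt (s := (range e)ᶜ) ?_ (hO.mem_nhds hw)
    rw [continuousOn_iff_continuous_domRestrict]
    have hi' := hi.continuous
    have : (range e)ᶜ.domRestrict r =
        fun w => i (P (w.1, ⟨φ w.1, hφpos w.1 w.2⟩)) := by
      ext w
      exact dif_neg w.2
    rw [this]
    fun_prop

/-! ### The topology on the union of interior and boundary. -/

/-- The disjoint union of `X` and `Z`, to be topologized so that points of `X` converge to a point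
of `Z` when their images under `q` converge to its image under `k`. -/
def BoundarySwap {X Z Ybar : Type u} (_q : X → Ybar) (_k : Z → Ybar) : Type u := X ⊕ Z

namespace BoundarySwap

variable {X Z Ybar : Type u} {q : X → Ybar} {k : Z → Ybar}

/-- The inclusion of the interior. -/
def inl (x : X) : BoundarySwap q k := Sum.inl x

/-- The inclusion of the boundary. -/
def inr (z : Z) : BoundarySwap q k := Sum.inr z

/-- The comparison map, equal to `q` on the interior and to `k` on the boundary. -/
def proj : BoundarySwap q k → Ybar := Sum.elim q k

@[simp] lemma proj_inl (x : X) : proj (inl x : BoundarySwap q k) = q x := rfl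

@[simp] lemma proj_inr (z : Z) : proj (inr z : BoundarySwap q k) = k z := rfl

lemma inl_injective : Function.Injective (inl : X → BoundarySwap q k) := Sum.inl_injective

lemma inr_injective : Function.Injective (inr : Z → BoundarySwap q k) := Sum.inr_injective

lemma inl_ne_inr (x : X) (z : Z) : (inl x : BoundarySwap q k) ≠ inr z := Sum.inl_ne_inr

lemma cases (p : BoundarySwap q k) : (∃ x, p = inl x) ∨ ∃ z, p = inr z := by
  rcases p with x | z
  exacts [Or.inl ⟨x, rfl⟩, Or.inr ⟨z, rfl⟩]

lemma range_inl : range (inl : X → BoundarySwap q k) = (range inr)ᶜ := by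
  ext p
  rcases p.cases with ⟨x, rfl⟩ | ⟨z, rfl⟩
  · simp [(inl_ne_inr x _).symm]
  · simp [inl_ne_inr]

variable [TopologicalSpace X] [TopologicalSpace Ybar]

instance : TopologicalSpace (BoundarySwap q k) where
  IsOpen O := IsOpen (inl ⁻¹' O) ∧
    ∀ z, inr z ∈ O → ∃ V : Set Ybar, IsOpen V ∧ k z ∈ V ∧ proj ⁻¹' V ⊆ O
  isOpen_univ := ⟨isOpen_univ, fun _ _ => ⟨univ, isOpen_univ, trivial, subset_univ _⟩⟩
  isOpen_inter := by
    rintro O O' ⟨h1, h2⟩ ⟨h1', h2'⟩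
    refine ⟨h1.inter h1', fun z hz => ?_⟩
    obtain ⟨V, hV, hzV, hVO⟩ := h2 z hz.1
    obtain ⟨V', hV', hzV', hVO'⟩ := h2' z hz.2
    exact ⟨V ∩ V', hV.inter hV', ⟨hzV, hzV'⟩, inter_subset_inter hVO hVO'⟩
  isOpen_sUnion := by
    intro 𝒪 h
    refine ⟨?_, fun z ⟨O, hO, hz⟩ => ?_⟩
    · rw [preimage_sUnion]
      exact isOpen_biUnion fun O hO => (h O hO).1
    · obtain ⟨V, hV, hzV, hVO⟩ := (h O hO).2 z hz
      exact ⟨V, hV, hzV, hVO.trans (subset_sUnion_of_mem hO)⟩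

lemma isOpen_iff {O : Set (BoundarySwap q k)} : IsOpen O ↔ IsOpen (inl ⁻¹' O) ∧
    ∀ z, inr z ∈ O → ∃ V : Set Ybar, IsOpen V ∧ k z ∈ V ∧ proj ⁻¹' V ⊆ O := Iff.rfl

lemma isOpenEmbedding_inl : IsOpenEmbedding (inl : X → BoundarySwap q k) := by
  refine .of_continuous_injective_isOpenMap ⟨fun O hO => hO.1⟩ inl_injective fun U hU => ?_
  refine isOpen_iff.2 ⟨by rwa [preimage_image_eq _ inl_injective], ?_⟩
  rintro z ⟨x, -, hx⟩
  exact absurd hx (inl_ne_inr x z)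

lemma continuous_proj (hq : Continuous q) : Continuous (proj : BoundarySwap q k → Ybar) :=
  ⟨fun V hV => isOpen_iff.2 ⟨hV.preimage hq, fun _ hz => ⟨V, hV, hz, Subset.rfl⟩⟩⟩

lemma nhds_inr (hq : Continuous q) (z : Z) :
    𝓝 (inr z : BoundarySwap q k) = Filter.comap proj (𝓝 (k z)) := by
  refine le_antisymm (continuous_proj hq).continuousAt.le_comap fun s hs => ?_
  obtain ⟨O, hOs, hO, hz⟩ := mem_nhds_iff.1 hs
  obtain ⟨V, hV, hzV, hVO⟩ := (isOpen_iff.1 hO).2 z hz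
  exact ⟨V, hV.mem_nhds hzV, hVO.trans hOs⟩

lemma tendsto_inr_iff (hq : Continuous q) {ι : Type*} {l : Filter ι} {F : ι → BoundarySwap q k}
    {z : Z} : Filter.Tendsto F l (𝓝 (inr z)) ↔ Filter.Tendsto (proj ∘ F) l (𝓝 (k z)) := by
  rw [nhds_inr hq, Filter.tendsto_comap_iff]

lemma comap_inl_nhds_inr (hq : Continuous q) (z : Z) :
    Filter.comap inl (𝓝 (inr z : BoundarySwap q k)) = Filter.comap q (𝓝 (k z)) := by
  rw [nhds_inr hq, Filter.comap_comap]
  rfl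

lemma isEmbedding_inr [TopologicalSpace Z] (hq : Continuous q) (hk : IsEmbedding k) :
    IsEmbedding (inr : Z → BoundarySwap q k) := by
  refine ⟨isInducing_iff_nhds.2 fun z => ?_, inr_injective⟩
  rw [nhds_inr hq, Filter.comap_comap, hk.isInducing.nhds_eq_comap]
  rfl

/-- As `q` need not be injective, two interior points are separated inside the open subspace `X`;
all other pairs are separated by `proj`. -/
lemma t2Space [T2Space X] [T2Space Ybar] (hq : Continuous q) (hk : Function.Injective k)
    (hqk : ∀ x z, q x ≠ k z) : T2Space (BoundarySwap q k) := by
  have hsep : ∀ p p' : BoundarySwap q k, proj p ≠ proj p' →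
      ∃ U V, IsOpen U ∧ IsOpen V ∧ p ∈ U ∧ p' ∈ V ∧ Disjoint U V := fun p p' h =>
    separated_by_continuous (continuous_proj hq) h
  refine ⟨fun p p' hne => ?_⟩
  rcases p.cases with ⟨x, rfl⟩ | ⟨z, rfl⟩ <;> rcases p'.cases with ⟨x', rfl⟩ | ⟨z', rfl⟩
  · exact separated_by_isOpenEmbedding isOpenEmbedding_inl fun h => hne (h ▸ rfl)
  · exact hsep _ _ (hqk x z')
  · exact hsep _ _ (hqk x' z).symm
  · exact hsep _ _ fun h => hne (hk h ▸ rfl)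

lemma secondCountableTopology [SecondCountableTopology X] [SecondCountableTopology Ybar]
    (hq : Continuous q) : SecondCountableTopology (BoundarySwap q k) := by
  refine (isTopologicalBasis_of_isOpen_of_nhds
    (s := (fun U => inl '' U) '' countableBasis X ∪ (fun V => proj ⁻¹' V) '' countableBasis Ybar)
    ?_ ?_).secondCountableTopology
    (((countable_countableBasis X).image _).union ((countable_countableBasis Ybar).image _))
  · rintro _ (⟨U, hU, rfl⟩ | ⟨V, hV, rfl⟩)
    · exact isOpenEmbedding_inl.isOpenMap _ (isOpen_of_mem_countableBasis hU)
    · exact (isOpen_of_mem_countableBasis hV).preimage (continuous_proj hq)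
  · intro p O hp hO
    rcases p.cases with ⟨x, rfl⟩ | ⟨z, rfl⟩
    · obtain ⟨U, hU, hxU, hUO⟩ := (isBasis_countableBasis X).exists_subset_of_mem_open
        (show x ∈ inl ⁻¹' O from hp) (isOpen_iff.1 hO).1
      exact ⟨_, Or.inl ⟨U, hU, rfl⟩, ⟨x, hxU, rfl⟩, image_subset_iff.2 hUO⟩
    · obtain ⟨V, hV, hzV, hVO⟩ := (isOpen_iff.1 hO).2 z hp
      obtain ⟨V', hV', hz, hVV⟩ := (isBasis_countableBasis Ybar).exists_subset_of_mem_open hzV hV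
      exact ⟨_, Or.inr ⟨V', hV', rfl⟩, hz, (preimage_mono hVV).trans hVO⟩

/-- The image of an ultrafilter converges in `Ybar`. A limit in the boundary is a limit upstairs;
otherwise `hproper` traps the ultrafilter in a compact subset of `X`. -/
lemma compactSpace [CompactSpace Ybar] [T2Space Ybar] (hq : Continuous q)
    (hproper : ∀ y ∉ range k, ∃ V ∈ 𝓝 y, ∃ L : Set X, IsCompact L ∧ q ⁻¹' V ⊆ L)
    (hk : IsCompact (range k)) : CompactSpace (BoundarySwap q k) := by
  refine ⟨isCompact_iff_ultrafilter_le_nhds'.2 fun 𝒰 _ => ?_⟩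
  obtain ⟨y, -, hy⟩ := isCompact_univ.ultrafilter_le_nhds' (𝒰.map proj) (Filter.univ_mem)
  have hy : Filter.Tendsto proj (𝒰 : Filter (BoundarySwap q k)) (𝓝 y) := hy
  by_cases hyk : y ∈ range k
  · obtain ⟨z, rfl⟩ := hyk
    exact ⟨inr z, trivial, (nhds_inr hq z).symm ▸ Filter.tendsto_iff_comap.1 hy⟩
  · obtain ⟨V, hV, L, hL, hVL⟩ := hproper y hyk
    have hsub : proj ⁻¹' (V ∩ (range k)ᶜ) ⊆ (inl '' L : Set (BoundarySwap q k)) := by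
      rintro p ⟨hpV, hpk⟩
      rcases p.cases with ⟨x, rfl⟩ | ⟨z, rfl⟩
      · exact ⟨x, hVL hpV, rfl⟩
      · exact absurd ⟨z, rfl⟩ hpk
    have hmem : (inl '' L : Set (BoundarySwap q k)) ∈ 𝒰 := Filter.mem_of_superset
      (hy (Filter.inter_mem hV (hk.isClosed.isOpen_compl.mem_nhds hyk))) hsub
    obtain ⟨p, -, hp⟩ := (hL.image isOpenEmbedding_inl.continuous).ultrafilter_le_nhds' 𝒰 hmem
    exact ⟨p, trivial, hp⟩

end BoundarySwap

/-! ### Convergence to the boundary and concatenation of homotopies. -/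

/-- Continuity of a map out of a compactification is tested on the interior and along approaches to
the boundary. -/
lemma continuous_of_interior_boundary {P Z Q B : Type*} [TopologicalSpace P] [TopologicalSpace Z]
    [TopologicalSpace Q] [TopologicalSpace B] {i : P → Q} {k : Z → Q} (hi : IsOpenEmbedding i)
    (hk : IsInducing k) (hik : range i = (range k)ᶜ) {F : Q → B} (h₁ : Continuous (F ∘ i))
    (h₂ : Continuous (F ∘ k))
    (h₃ : ∀ z, Filter.Tendsto (F ∘ i) (Filter.comap i (𝓝 (k z))) (𝓝 (F (k z)))) :
    Continuous F := by
  refine continuous_iff_continuousAt.2 fun p => ?_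
  by_cases hp : p ∈ range k
  · obtain ⟨z, rfl⟩ := hp
    have key : 𝓝 (k z) ≤ Filter.map i (Filter.comap i (𝓝 (k z))) ⊔
        Filter.map k (Filter.comap k (𝓝 (k z))) := by
      rw [Filter.map_comap, Filter.map_comap, ← inf_sup_left, Filter.sup_principal, hik,
        compl_union_self, Filter.principal_univ, inf_top_eq]
    refine Filter.Tendsto.mono_left (Filter.tendsto_sup.2 ⟨?_, ?_⟩) key
    · exact Filter.tendsto_map'_iff.2 (h₃ z)
    · rw [← hk.nhds_eq_comap]
      exact Filter.tendsto_map'_iff.2 (h₂.tendsto z)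
  · obtain ⟨x, rfl⟩ : p ∈ range i := hik ▸ hp
    exact (hi.continuousAt_iff).1 h₁.continuousAt

namespace IsZStructure

variable {G : Type v} [Group G] {Y Z Ybar : Type u} [MetricSpace Y] [MulAction G Y]
  [TopologicalSpace Z] [TopologicalSpace Ybar] {j : Y → Ybar} {k : Z → Ybar}

lemma isOpenEmbedding_interior (h : IsZStructure G j k) : IsOpenEmbedding j :=
  ⟨h.isEmbedding_interior, by rw [h.range_interior]; exact h.isZSet.1.isOpen_compl⟩

lemma interior_ne_boundary (h : IsZStructure G j k) (y : Y) (z : Z) : j y ≠ k z := fun e => by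
  have : j y ∈ (range k)ᶜ := h.range_interior ▸ mem_range_self y
  exact this ⟨z, e.symm⟩

/-- If two families of points stay in common translates of a compact set, then they converge to the
same boundary points. -/
lemma tendsto_of_common_translate (h : IsZStructure G j k) {ι : Type*} {l : Filter ι}
    {u v : ι → Y} {K : Set Y} (hK : IsCompact K)
    (huv : ∀ n, ∃ g : G, u n ∈ g • K ∧ v n ∈ g • K) {z : Z}
    (hu : Filter.Tendsto (fun n => j (u n)) l (𝓝 (k z))) :
    Filter.Tendsto (fun n => j (v n)) l (𝓝 (k z)) := by
  have := h.isAR.2.1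
  have := h.compactSpace
  have := h.isGeometricAction.continuousConstSMul
  refine (nhds_basis_opens _).tendsto_right_iff.2 fun V ⟨hzV, hV⟩ => ?_
  obtain ⟨C, hzC, hC, hCV⟩ := exists_mem_nhds_isClosed_subset (hV.mem_nhds hzV)
  -- All but finitely many translates that meet `C` lie in `V`. The exceptional ones have compact
  -- union in the interior, which misses a neighbourhood of `k z`.
  have hfin := h.nullity K hK {V, Cᶜ} (by
    rintro U (rfl | rfl)
    exacts [hV, hC.isOpen_compl]) (by
    rw [sUnion_pair, eq_univ_iff_forall]
    intro p
    by_cases hp : p ∈ C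
    exacts [Or.inl (hCV hp), Or.inr hp])
  set E : Set G := {g | ¬ ∃ U ∈ ({V, Cᶜ} : Set (Set Ybar)), j '' (g • K) ⊆ U} with hE
  have hQ : IsCompact (j '' ⋃ g ∈ E, g • K) :=
    (hfin.isCompact_biUnion fun g _ => hK.smul g).image h.isOpenEmbedding_interior.continuous
  have hzQ : k z ∉ j '' ⋃ g ∈ E, g • K := by
    rintro ⟨y, -, hy⟩
    exact h.interior_ne_boundary y z hy
  filter_upwards [hu hzC, hu (hQ.isClosed.isOpen_compl.mem_nhds hzQ)] with n hn1 hn2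
  obtain ⟨g, hug, hvg⟩ := huv n
  have hg : ∃ U ∈ ({V, Cᶜ} : Set (Set Ybar)), j '' (g • K) ⊆ U := by
    by_contra hg
    exact hn2 ⟨u n, mem_biUnion (show g ∈ E from hg) hug, rfl⟩
  obtain ⟨U, rfl | rfl, hU⟩ := hg
  · exact hU ⟨v n, hvg, rfl⟩
  · exact absurd hn1 (hU ⟨u n, hug, rfl⟩)

end IsZStructure

/-- Controlled maps between spaces with geometric actions are proper. -/
lemma IsControlled.preimage_subset_isCompact {G : Type v} [Group G] {X Y : Type*} [MetricSpace X]
    [MulAction G X] [MetricSpace Y] [MulAction G Y] (hX : IsGeometricAction G X)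
    (hY : IsGeometricAction G Y) {f : X → Y} (hf : IsControlled G f) {C : Set Y}
    (hC : IsCompact C) : ∃ L : Set X, IsCompact L ∧ f ⁻¹' C ⊆ L := by
  have := hX.continuousConstSMul
  obtain ⟨K, hK, hcov⟩ := hX.cocompact
  obtain ⟨K', hK', hfK⟩ := hf K hK
  refine ⟨_, (hY.finite_inter hK' hC).isCompact_biUnion fun g _ => hK.smul g, fun x hx => ?_⟩
  obtain ⟨g, hg⟩ := mem_iUnion.1 (hcov.symm ▸ mem_univ x : x ∈ ⋃ g : G, g • K)
  exact mem_biUnion (show g ∈ {g : G | ((g • K') ∩ C).Nonempty} from ⟨f x, hfK g hg, hx⟩) hg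

/-- A closed set in a metrizable space is the zero set of a map to the unit interval. -/
lemma exists_zeroSet_eq {T : Type*} [TopologicalSpace T] [MetrizableSpace T] {A : Set T}
    (hA : IsClosed A) : ∃ s : C(T, unitInterval), ∀ x, s x = 0 ↔ x ∈ A := by
  let _ := metrizableSpaceMetric T
  rcases A.eq_empty_or_nonempty with rfl | hne
  · exact ⟨.const _ 1, by simp⟩
  · refine ⟨⟨fun x => projIcc 0 1 zero_le_one (Metric.infDist x A), by fun_prop⟩, fun x => ?_⟩
    have h : projIcc (0 : ℝ) 1 zero_le_one (Metric.infDist x A) = 0 ↔ Metric.infDist x A ≤ 0 :=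
      projIcc_eq_left zero_lt_one
    rw [hA.mem_iff_infDist_zero hne, ContinuousMap.coe_mk, h]
    exact ⟨fun h => h.antisymm Metric.infDist_nonneg, fun h => h.le⟩

/-- A homotopy `J` that fixes `A` pointwise, run up to a time `s` that vanishes on `A` exactly, can
be followed by any homotopy that starts where `J` ends. -/
lemma exists_concat_homotopy {T : Type*} [TopologicalSpace T] (s : C(T, unitInterval))
    (J β : C(T × unitInterval, T)) (hJ : ∀ x t, s x = 0 → J (x, t) = x)
    (hJβ : ∀ x, J (x, 1) = β (x, 0)) :
    ∃ α : C(T × unitInterval, T), ∀ x t,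
      (t ≤ s x → ∃ t', (t = 0 → t' = 0) ∧ α (x, t) = J (x, t')) ∧
      (s x < t → ∃ t' : unitInterval, 0 < t' ∧ α (x, t) = β (x, t')) := by
  set a : T × unitInterval → unitInterval := fun p =>
    projIcc 0 1 zero_le_one ((p.2 : ℝ) / max (s p.1 : ℝ) p.2) with ha
  set b : T × unitInterval → unitInterval := fun p =>
    projIcc 0 1 zero_le_one ((p.2 : ℝ) - s p.1) with hb
  have hbc : Continuous b := by fun_prop
  have hJc : Continuous fun p : T × unitInterval => J (p.1, a p) := by
    refine continuous_iff_continuousAt.2 fun ⟨x, t⟩ => ?_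
    rcases (show 0 ≤ max (s x : ℝ) t from le_max_of_le_left (s x).2.1).eq_or_lt with h0 | hpos
    · have hs : s x = 0 := Subtype.ext (le_antisymm ((le_max_left _ _).trans h0.ge) (s x).2.1)
      refine Filter.tendsto_def.2 fun V hV => ?_
      replace hV : V ∈ 𝓝 x := by simpa only [hJ _ _ hs] using hV
      have := isCompact_univ.eventually_forall_of_forall_eventually (x₀ := x)
        (P := fun (y : T) (t : unitInterval) => J (y, t) ∈ V)
        (fun t _ => J.continuous.continuousAt (by rwa [hJ x t hs]))
      rw [nhds_prod_eq]
      filter_upwards [this.prod_inl (𝓝 t)] with p hp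
      exact hp _ trivial
    · refine J.continuous.continuousAt.comp (continuousAt_fst.prodMk ?_)
      refine continuous_projIcc.continuousAt.comp (ContinuousAt.div ?_ ?_ hpos.ne') <;>
        exact Continuous.continuousAt (by fun_prop)
  have hα : Continuous fun p : T × unitInterval =>
      if p.2 ≤ s p.1 then J (p.1, a p) else β (p.1, b p) := by
    refine Continuous.if_le hJc (by fun_prop) continuous_snd (by fun_prop) ?_
    rintro ⟨x, t⟩ (rfl : t = s x)
    have hb0 : b (x, s x) = 0 := by simp [hb]
    rw [hb0, ← hJβ]
    by_cases hs : s x = 0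
    · rw [hJ _ _ hs, hJ _ _ hs]
    · have hs' : (s x : ℝ) ≠ 0 := fun h => hs (Subtype.ext h)
      have : a (x, s x) = 1 := by simp [ha, hs']
      rw [this]
  refine ⟨⟨_, hα⟩, fun x t => ⟨fun h => ⟨a (x, t), ?_, if_pos h⟩, fun h =>
    ⟨b (x, t), ?_, if_neg h.not_ge⟩⟩⟩
  · rintro rfl
    simp [ha]
  · have : (0 : ℝ) < (t : ℝ) - s x := sub_pos.2 h
    change (0 : ℝ) < b (x, t)
    simpa [hb, coe_projIcc] using h

/-! ### The swapped compactification. -/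

section BoundarySwapping

variable {G : Type v} [Group G] {X Y : Type u}
  [MetricSpace X] [MulAction G X] [MetricSpace Y] [MulAction G Y]
  {Z Ybar : Type u} [TopologicalSpace Z] [TopologicalSpace Ybar] {j : Y → Ybar} {k : Z → Ybar}

namespace BoundarySwap

/-- A controlled map between the interiors extends by the identity on the boundary. -/
lemma exists_extension_of_controlled (h : IsZStructure G j k) (f : C(X, Y))
    (hf : IsControlled G f) (p : C(Y, X)) (hp : IsControlled G p) :
    ∃ F : C(Ybar, BoundarySwap (j ∘ f) k), (∀ y, F (j y) = inl (p y)) ∧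
      ∀ z, F (k z) = inr z := by
  have hq : Continuous (j ∘ f) := h.isOpenEmbedding_interior.continuous.comp f.continuous
  have hF : ∀ b : Ybar, ∃ t : BoundarySwap (j ∘ f) k,
      (∀ y, j y = b → t = inl (p y)) ∧ ∀ z, k z = b → t = inr z := by
    intro b
    by_cases hb : b ∈ range k
    · obtain ⟨z, rfl⟩ := hb
      exact ⟨inr z, fun y hy => absurd hy (h.interior_ne_boundary y z),
        fun z' hz' => by rw [h.isEmbedding_boundary.injective hz']⟩
    · obtain ⟨y, rfl⟩ : b ∈ range j := h.range_interior ▸ hb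
      exact ⟨inl (p y), fun y' hy' => by rw [h.isEmbedding_interior.injective hy'],
        fun z hz => absurd ⟨z, hz⟩ hb⟩
  choose F hFj hFk using hF
  have hFj : ∀ y, F (j y) = inl (p y) := fun y => hFj _ y rfl
  have hFk : ∀ z, F (k z) = inr z := fun z => hFk _ z rfl
  refine ⟨⟨F, ?_⟩, hFj, hFk⟩
  refine continuous_of_interior_boundary h.isOpenEmbedding_interior
    h.isEmbedding_boundary.isInducing h.range_interior ?_ ?_ fun z => ?_
  · rw [show F ∘ j = inl ∘ p from funext hFj]
    exact isOpenEmbedding_inl.continuous.comp p.continuous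
  · rw [show F ∘ k = inr from funext hFk]
    exact (isEmbedding_inr hq h.isEmbedding_boundary).continuous
  · rw [hFk, tendsto_inr_iff hq, show F ∘ j = inl ∘ p from funext hFj]
    have := h.isGeometricAction.continuousConstSMul
    obtain ⟨K, hK, hcov⟩ := h.isGeometricAction.cocompact
    obtain ⟨L, hL, hpL⟩ := (hf.comp hp) K hK
    -- `y` and `f (p y)` lie in a common translate, so they approach the same boundary points.
    refine h.tendsto_of_common_translate (u := id) (v := f ∘ p) (hK.union hL) (fun y => ?_)
      Filter.tendsto_comap
    obtain ⟨g, hg⟩ := mem_iUnion.1 (hcov.symm ▸ mem_univ y : y ∈ ⋃ g : G, g • K)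
    exact ⟨g, smul_set_mono subset_union_left hg, smul_set_mono subset_union_right (hpL g hg)⟩

/-- A controlled homotopy of the interior extends by the constant homotopy of the boundary. -/
lemma exists_homotopy_extension (h : IsZStructure G j k) (f : C(X, Y)) (hf : IsControlled G f)
    (hGX : IsGeometricAction G X) (J : C(X × unitInterval, X))
    (hJ : ∀ C : Set X, IsCompact C → ∃ C' : Set X, IsCompact C' ∧
        ∀ g : G, ∀ x ∈ g • C, ∀ t, J (x, t) ∈ g • C') :
    ∃ F : C(BoundarySwap (j ∘ f) k × unitInterval, BoundarySwap (j ∘ f) k),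
      (∀ x t, F (inl x, t) = inl (J (x, t))) ∧ ∀ z t, F (inr z, t) = inr z := by
  have hq : Continuous (j ∘ f) := h.isOpenEmbedding_interior.continuous.comp f.continuous
  have hgeo := hGX.continuousConstSMul
  set F : BoundarySwap (j ∘ f) k × unitInterval → BoundarySwap (j ∘ f) k := fun r =>
    Sum.elim (fun x => inl (J (x, r.2))) (fun z => inr z) r.1 with hF
  refine ⟨⟨F, ?_⟩, fun _ _ => rfl, fun _ _ => rfl⟩
  refine continuous_of_interior_boundary (i := Prod.map inl id) (k := Prod.map inr id)
    (isOpenEmbedding_inl.prodMap .id)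
    ((isEmbedding_inr hq h.isEmbedding_boundary).isInducing.prodMap .id) ?_ ?_ ?_ ?_
  · ext ⟨r, t⟩
    rcases r.cases with ⟨x, rfl⟩ | ⟨z, rfl⟩
    · simp [(inl_ne_inr x _).symm]
    · simp [inl_ne_inr]
  · exact isOpenEmbedding_inl.continuous.comp J.continuous
  · exact (isEmbedding_inr hq h.isEmbedding_boundary).continuous.comp continuous_fst
  · rintro ⟨z, t⟩
    change Filter.Tendsto _ _ (𝓝 (inr z))
    rw [tendsto_inr_iff hq]
    obtain ⟨K, hK, hcov⟩ := hGX.cocompact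
    obtain ⟨K₁, hK₁, hJK⟩ := hJ K hK
    obtain ⟨L, hL, hfL⟩ := hf _ (hK.union hK₁)
    refine h.tendsto_of_common_translate (u := fun r : X × unitInterval => f r.1)
      (v := fun r : X × unitInterval => f (J r)) hL (fun r => ?_) ?_
    · obtain ⟨g, hg⟩ := mem_iUnion.1 (hcov.symm ▸ mem_univ r.1 : r.1 ∈ ⋃ g : G, g • K)
      exact ⟨g, hfL g (smul_set_mono subset_union_left hg),
        hfL g (smul_set_mono subset_union_right (hJK g _ hg r.2))⟩
    · have h1 := ((continuous_proj (k := k) hq).tendsto (inr z)).comp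
        ((continuous_fst.tendsto (inr z, t)).comp
          (Filter.tendsto_comap (f := Prod.map inl (id : unitInterval → unitInterval))))
      exact h1

/-- An extension of the action on `Y` to its compactification induces an extension of the action on
`X` to the swapped compactification, with the same restriction to the boundary. -/
theorem exists_action (hGX : IsGeometricAction G X) (h : IsZStructure G j k)
    (f : C(X, Y)) (hf : IsControlled G f) (ρ : G →* (Ybar ≃ₜ Ybar))
    (hρ : ∀ (g : G) (y : Y), ρ g (j y) = j (g • y)) :
    ∃ σ : G →* (BoundarySwap (j ∘ f) k ≃ₜ BoundarySwap (j ∘ f) k),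
      (∀ (g : G) (x : X), σ g (inl x) = inl (g • x)) ∧
      ∀ (g : G) (z z' : Z), ρ g (k z) = k z' → σ g (inr z) = inr z' := by
  have hq : Continuous (j ∘ f) := h.isOpenEmbedding_interior.continuous.comp f.continuous
  have := hGX.continuousConstSMul
  have := h.isGeometricAction.continuousConstSMul
  have hinj := h.isEmbedding_boundary.injective
  -- `ρ g` preserves the boundary because `ρ g⁻¹` preserves the interior.
  have hθ : ∀ (g : G) (z : Z), ∃ z', k z' = ρ g (k z) := by
    intro g z
    by_contra hz
    obtain ⟨y, hy⟩ : ρ g (k z) ∈ range j := h.range_interior ▸ hz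
    apply h.interior_ne_boundary (g⁻¹ • y) z
    rw [← hρ, hy, map_inv]
    exact (ρ g).symm_apply_apply _
  choose θ hθ using hθ
  have hθmul : ∀ g g' z, θ (g * g') z = θ g (θ g' z) := fun g g' z => hinj (by
    rw [hθ, hθ, hθ, map_mul]
    rfl)
  have hθ1 : ∀ z, θ 1 z = z := fun z => hinj (by
    rw [hθ, map_one]
    rfl)
  have hθc : ∀ g, Continuous (θ g) := fun g => by
    rw [h.isEmbedding_boundary.continuous_iff, show k ∘ θ g = ρ g ∘ k from funext (hθ g)]
    exact (ρ g).continuous.comp h.isEmbedding_boundary.continuous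
  let σ : G → BoundarySwap (j ∘ f) k → BoundarySwap (j ∘ f) k := fun g =>
    Sum.elim (fun x => inl (g • x)) fun z => inr (θ g z)
  have hσx : ∀ g x, σ g (inl x) = inl (g • x) := fun _ _ => rfl
  have hσz : ∀ g z, σ g (inr z) = inr (θ g z) := fun _ _ => rfl
  have hσmul : ∀ g g' x, σ (g * g') x = σ g (σ g' x) := by
    intro g g' x
    rcases x.cases with ⟨x, rfl⟩ | ⟨z, rfl⟩
    · simp only [hσx, mul_smul]
    · simp only [hσz, hθmul]
  have hσ1 : ∀ x, σ 1 x = x := by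
    intro x
    rcases x.cases with ⟨x, rfl⟩ | ⟨z, rfl⟩
    · simp only [hσx, one_smul]
    · simp only [hσz, hθ1]
  have hσc : ∀ g, Continuous (σ g) := by
    intro g
    refine continuous_of_interior_boundary isOpenEmbedding_inl
      (isEmbedding_inr hq h.isEmbedding_boundary).isInducing range_inl ?_ ?_ fun z => ?_
    · exact isOpenEmbedding_inl.continuous.comp (continuous_const_smul g)
    · exact (isEmbedding_inr hq h.isEmbedding_boundary).continuous.comp (hθc g)
    · rw [hσz, tendsto_inr_iff hq, comap_inl_nhds_inr hq]
      obtain ⟨K, hK, hcov⟩ := hGX.cocompact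
      obtain ⟨L, hL, hfL⟩ := hf K hK
      -- `f` is not equivariant, but `g • f x` and `f (g • x)` share a translate.
      refine h.tendsto_of_common_translate (u := fun x => g • f x) (v := fun x => f (g • x)) hL
        (fun x => ?_) ?_
      · obtain ⟨g', hg⟩ := mem_iUnion.1 (hcov.symm ▸ mem_univ x : x ∈ ⋃ g : G, g • K)
        refine ⟨g * g', ?_, hfL _ ?_⟩ <;> rw [mul_smul]
        exacts [smul_mem_smul_set (hfL g' hg), smul_mem_smul_set hg]
      · have := ((ρ g).continuous.tendsto (k z)).comp (Filter.tendsto_comap (f := j ∘ f))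
        rw [hθ]
        exact this.congr fun x => hρ g (f x)
  refine ⟨MonoidHom.mk' (fun g => ⟨⟨σ g, σ g⁻¹, fun x => ?_, fun x => ?_⟩, hσc g, hσc g⁻¹⟩)
    fun g g' => Homeomorph.ext (hσmul g g'), hσx, fun g z z' hz => ?_⟩
  · rw [← hσmul, inv_mul_cancel, hσ1]
  · rw [← hσmul, mul_inv_cancel, hσ1]
  · exact congrArg inr (hinj ((hθ g z).trans hz))

lemma compact_metrizable [ProperSpace X] [ProperSpace Y]
    (hGX : IsGeometricAction G X) (h : IsZStructure G j k)
    (f : C(X, Y))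
    (hf : IsControlled G f) :
    CompactSpace (BoundarySwap (j ∘ f) k) ∧ MetrizableSpace (BoundarySwap (j ∘ f) k) := by
  have hq : Continuous (j ∘ f) := h.isOpenEmbedding_interior.continuous.comp f.continuous
  have := h.compactSpace
  have := h.isAR.2.1
  have := h.isAR.2.2.1
  have : SecondCountableTopology Ybar := by
    let _ := metrizableSpaceMetric Ybar
    exact UniformSpace.secondCountable_of_separable Ybar
  have : CompactSpace (BoundarySwap (j ∘ f) k) := by
    refine compactSpace hq (fun b hb => ?_) h.isZSet.1.isCompact
    obtain ⟨y, rfl⟩ : b ∈ range j := h.range_interior ▸ hb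
    obtain ⟨C, hC, hy⟩ := exists_compact_mem_nhds y
    obtain ⟨L, hL, hfL⟩ := hf.preimage_subset_isCompact hGX h.isGeometricAction hC
    refine ⟨j '' C, h.isOpenEmbedding_interior.image_mem_nhds.2 hy, L, hL, ?_⟩
    rwa [preimage_comp, preimage_image_eq _ h.isEmbedding_interior.injective]
  have : T2Space (BoundarySwap (j ∘ f) k) :=
    t2Space hq h.isEmbedding_boundary.injective fun x z => h.interior_ne_boundary (f x) z
  have : SecondCountableTopology (BoundarySwap (j ∘ f) k) := secondCountableTopology hq
  exact ⟨inferInstance, metrizableSpace_of_t3_secondCountable _⟩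

/-- The nullity condition passes to the swapped compactification. -/
lemma nullity [ProperSpace Y] [Nonempty X] (h : IsZStructure G j k) (f : C(X, Y))
    (hf : IsControlled G f) {C : Set X} (hC : IsCompact C)
    {𝒰 : Set (Set (BoundarySwap (j ∘ f) k))} (h𝒰 : ∀ U ∈ 𝒰, IsOpen U) (hcov : ⋃₀ 𝒰 = univ) :
    {g : G | ¬ ∃ U ∈ 𝒰, inl '' (g • C) ⊆ U}.Finite := by
  rcases C.eq_empty_or_nonempty with rfl | ⟨c, hc⟩
  · rcases 𝒰.eq_empty_or_nonempty with rfl | ⟨U, hU⟩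
    · obtain ⟨x⟩ := ‹Nonempty X›
      rw [sUnion_empty] at hcov
      exact absurd (hcov ▸ mem_univ (inl x)) (notMem_empty _)
    · have : ∃ U, U ∈ 𝒰 := ⟨U, hU⟩
      simp [this]
  obtain ⟨C', hC', hfC⟩ := hf C hC
  have hz : ∀ z, ∃ V : Set Ybar, IsOpen V ∧ k z ∈ V ∧
      ∃ U ∈ 𝒰, (proj ⁻¹' V : Set (BoundarySwap (j ∘ f) k)) ⊆ U := by
    intro z
    obtain ⟨U, hU, hzU⟩ := mem_sUnion.1 (hcov ▸ mem_univ (inr z) : inr z ∈ ⋃₀ 𝒰)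
    obtain ⟨V, hV, hzV, hVU⟩ := (isOpen_iff.1 (h𝒰 U hU)).2 z hzU
    exact ⟨V, hV, hzV, U, hU, hVU⟩
  choose V hVo hzV hVU using hz
  have hy : ∀ y : Y, ∃ W : Set Y, IsOpen W ∧ y ∈ W ∧ ∃ Q, IsCompact Q ∧ W ⊆ Q := by
    intro y
    obtain ⟨Q, hQ, hyQ⟩ := exists_compact_mem_nhds y
    exact ⟨interior Q, isOpen_interior, mem_interior_iff_mem_nhds.2 hyQ, Q, hQ, interior_subset⟩
  choose W hWo hyW Q hQ hWQ using hy
  have := h.compactSpace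
  -- Boundary members pull back into members of `𝒰`; interior members are relatively compact. By
  -- properness, only finitely many translates of `C'` meet the finitely many interior members of a
  -- subcover.
  let O : Z ⊕ Y → Set Ybar := Sum.elim V fun y => j '' W y
  obtain ⟨t, ht⟩ := isCompact_univ.elim_finite_subcover O
    (by
      rintro (z | y)
      exacts [hVo z, h.isOpenEmbedding_interior.isOpenMap _ (hWo y)])
    (by
      intro b _
      by_cases hb : b ∈ range k
      · obtain ⟨z, rfl⟩ := hb
        exact mem_iUnion.2 ⟨Sum.inl z, hzV z⟩
      · obtain ⟨y, rfl⟩ : b ∈ range j := h.range_interior ▸ hb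
        exact mem_iUnion.2 ⟨Sum.inr y, y, hyW y, rfl⟩)
  have hfin₁ := h.nullity C' hC' (O '' t)
    (by
      rintro _ ⟨z | y, -, rfl⟩
      exacts [hVo z, h.isOpenEmbedding_interior.isOpenMap _ (hWo y)])
    (by
      rw [sUnion_image]
      exact univ_subset_iff.1 ht)
  have hQt : IsCompact (⋃ a ∈ t, Sum.elim (fun _ => ∅) Q a) := t.isCompact_biUnion fun a _ => by
    rcases a with z | y
    exacts [isCompact_empty, hQ y]
  refine (hfin₁.union (h.isGeometricAction.finite_inter hC' hQt)).subset fun g hg => ?_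
  by_contra hg'
  rw [mem_union, not_or] at hg'
  obtain ⟨_, ⟨a, hat, rfl⟩, ha⟩ := not_not.1 hg'.1
  have hfc : ∀ x ∈ g • C, f x ∈ g • C' := fun x hx => hfC g hx
  rcases a with z | y
  · obtain ⟨U, hU, hVU⟩ := hVU z
    refine hg ⟨U, hU, ?_⟩
    rintro _ ⟨x, hx, rfl⟩
    exact hVU (ha ⟨f x, hfc x hx, rfl⟩)
  · have hgc := hfc _ (smul_mem_smul_set hc)
    obtain ⟨y', hy', he⟩ := ha ⟨_, hgc, rfl⟩
    rw [h.isEmbedding_interior.injective he] at hy'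
    exact hg'.2 ⟨_, hgc, mem_biUnion hat (hWQ y hy')⟩

/-- The homotopy of the swapped compactification runs the controlled homotopy from the identity to
the composite `X → Y → X`, followed by the image of the given homotopy of `Ybar`. -/
lemma isZSet_range_inr [ProperSpace X] [ProperSpace Y]
    (hX : IsAR X) (hGX : IsGeometricAction G X) (h : IsZStructure G j k)
    (f : C(X, Y)) (hf : IsControlled G f) :
    IsZSet (range (inr : Z → BoundarySwap (j ∘ f) k)) := by
  have hcl : IsClosed (range (inr : Z → BoundarySwap (j ∘ f) k)) := by
    rw [← isOpen_compl_iff, ← range_inl]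
    exact isOpenEmbedding_inl.isOpen_range
  have hq : Continuous (j ∘ f) := h.isOpenEmbedding_interior.continuous.comp f.continuous
  obtain ⟨-, hmet⟩ := compact_metrizable hGX h f hf
  obtain ⟨p, hp⟩ := hX.exists_controlled_map h.isGeometricAction hGX
  obtain ⟨J, hJ₀, hJ₁, hJ⟩ := hX.exists_controlled_homotopy hGX (p.comp f) (hp.comp hf)
  obtain ⟨P, hPj, hPk⟩ := exists_extension_of_controlled h f hf p hp
  obtain ⟨J', hJ'x, hJ'z⟩ := exists_homotopy_extension h f hf hGX J hJ
  obtain ⟨β, hβ₀, hβ⟩ := h.isZSet.2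
  -- Boundary points switch to the second homotopy at once and leave the boundary; interior points
  -- stay in `X` during the first.
  obtain ⟨s, hs⟩ := exists_zeroSet_eq hcl
  let q : C(BoundarySwap (j ∘ f) k, Ybar) := ⟨proj, continuous_proj hq⟩
  obtain ⟨α, hα⟩ := exists_concat_homotopy s J' (P.comp (β.comp (q.prodMap (.id unitInterval))))
    (by
      intro x t hx
      obtain ⟨z, rfl⟩ := (hs x).1 hx
      exact hJ'z z t)
    (by
      intro x
      rcases x.cases with ⟨x, rfl⟩ | ⟨z, rfl⟩
      · simp [q, hJ'x, hJ₁, hβ₀, hPj]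
      · simp [q, hJ'z, hβ₀, hPk])
  refine ⟨hcl, α, fun x => ?_, fun x t ht => ?_⟩
  · obtain ⟨t', ht', h1⟩ := (hα x 0).1 (s x).2.1
    rw [h1, ht' rfl]
    rcases x.cases with ⟨x, rfl⟩ | ⟨z, rfl⟩
    · rw [hJ'x, hJ₀]
    · rw [hJ'z]
  · rcases le_or_gt t (s x) with hts | hts
    · obtain ⟨t', -, h1⟩ := (hα x t).1 hts
      rcases x.cases with ⟨x, rfl⟩ | ⟨z, rfl⟩
      · rw [h1, hJ'x]
        rintro ⟨z, hz⟩
        exact inl_ne_inr _ _ hz.symm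
      · rw [(hs _).2 ⟨z, rfl⟩] at hts
        exact absurd ht hts.not_gt
    · obtain ⟨t', ht', h1⟩ := (hα x t).2 hts
      have h2 : β (proj x, t') ∈ range j := h.range_interior ▸ hβ (proj x) t' ht'
      obtain ⟨y, hy⟩ := h2
      have h3 : α (x, t) = P (β (proj x, t')) := h1
      rw [h3, ← hy, hPj]
      rintro ⟨z, hz⟩
      exact inl_ne_inr _ _ hz.symm

theorem isZStructure [ProperSpace X] [ProperSpace Y]
    (hX : IsAR X) (hGX : IsGeometricAction G X) (h : IsZStructure G j k)
    (f : C(X, Y)) (hf : IsControlled G f) :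
    IsZStructure G (inl : X → BoundarySwap (j ∘ f) k) inr := by
  have hq : Continuous (j ∘ f) := h.isOpenEmbedding_interior.continuous.comp f.continuous
  obtain ⟨hcpt, hmet⟩ := compact_metrizable hGX h f hf
  have := hX.nonempty
  have hZ := isZSet_range_inr hX hGX h f hf
  refine ⟨isOpenEmbedding_inl.isEmbedding, isEmbedding_inr hq h.isEmbedding_boundary, range_inl,
    hcpt, ?_, hZ, inferInstance, hGX, fun C hC 𝒰 h𝒰 hcov => nullity h f hf hC h𝒰 hcov⟩
  obtain ⟨-, H, hH₀, hH⟩ := hZ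
  refine hX.of_instant_homotopy isOpenEmbedding_inl.isEmbedding H hH₀ fun x t ht => ?_
  rw [range_inl]
  exact hH x t ht

end BoundarySwap

end BoundarySwapping

theorem theorem1p3 {G : Type v} [Group G] {X Y : Type u}
    [MetricSpace X] [ProperSpace X] [MulAction G X]
    [MetricSpace Y] [ProperSpace Y] [MulAction G Y]
    (hX : IsAR X) (hGX : IsGeometricAction G X)
    (hY : IsAR Y) (hGY : IsGeometricAction G Y)
    {Z Ybar : Type u} [TopologicalSpace Z] [TopologicalSpace Ybar]
    (j : Y → Ybar) (k : Z → Ybar) :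
    (IsZStructure G j k →
      ∃ (Xbar : Type u) (_ : TopologicalSpace Xbar) (i : X → Xbar) (l : Z → Xbar),
        IsZStructure G i l) ∧
    (∀ ρ : G →* (Ybar ≃ₜ Ybar), IsEZStructure j k ρ →
      ∃ (Xbar : Type u) (_ : TopologicalSpace Xbar) (i : X → Xbar) (l : Z → Xbar)
        (σ : G →* (Xbar ≃ₜ Xbar)), IsEZStructure i l σ ∧
          ∀ (g : G) (z z' : Z), ρ g (k z) = k z' → σ g (l z) = l z') := by
  have main : ∀ h : IsZStructure G j k, ∃ f : C(X, Y), IsControlled G f ∧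
      IsZStructure G (BoundarySwap.inl : X → BoundarySwap (j ∘ f) k) BoundarySwap.inr := by
    intro h
    obtain ⟨f, hf⟩ := hY.exists_controlled_map hGX hGY
    exact ⟨f, hf, BoundarySwap.isZStructure hX hGX h f hf⟩
  refine ⟨fun h => ?_, fun ρ h => ?_⟩
  · obtain ⟨f, -, hf⟩ := main h
    exact ⟨_, _, _, _, hf⟩
  · obtain ⟨f, hf, hZ⟩ := main h.isZStructure
    obtain ⟨σ, hσ, hσk⟩ := BoundarySwap.exists_action hGX h.isZStructure f hf ρ h.extends_action
    exact ⟨_, _, _, _, σ, ⟨hZ, hσ⟩, hσk⟩
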